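/- Let $R$ be a commutative Noetherian local ring, and let $M$ and $N$ be non-zero finitely generated $R$-modules. Write $\operatorname{pd}_R M$ for the projective dimension of $M$, and put $\operatorname{grade}(M,N)=\inf\{i\ge 0 : \operatorname{Ext}^i_R(M,N)\neq 0\}$. The module $M$ is called $N$-perfect if $\operatorname{pd}_R M<\infty$ and $\operatorname{pd}_R M=\operatorname{grade}(M,N)$. For an integer $k\ge 0$, a finitely generated $R$-module $L$ satisfies Serre's condition $(S_k)$ if $\operatorname{depth}_{R_{\mathfrak p}} L_{\mathfrak p}\ge \min(k,\dim L_{\mathfrak p})$ for every $\mathfrak p\in\operatorname{Supp} L$. Theorem 2.1. Let $n\ge 0$ be an integer and suppose that $N$ satisfies $(S_n)$. Suppose that $M$ is $N$-perfect with $t=\operatorname{pd}_R M\le n$, and that $\operatorname{Tor}_i^R(M,N)=0$ for all $i>0$. Then $M\otimes_R N$ satisfies $(S_{n-t})$. -/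

import Mathlib

open CategoryTheory

universe u

/-- The depth of a module `M` over a local ring `R`: the supremum of the lengths of the
sequences `x₁, …, xᵣ` in the maximal ideal such that each `xᵢ` is a nonzerodivisor on
`M / (x₁, …, xᵢ₋₁) M`. For `M` finitely generated and nonzero the condition
`M ≠ (x₁, …, xᵣ) M` is automatic by Nakayama's lemma; the zero module has depth `∞`. -/
noncomputable def localDepth (R : Type u) [CommRing R] [IsLocalRing R]
    (M : Type u) [AddCommGroup M] [Module R M] : ℕ∞ :=
  ⨆ (rs : List R) (_ : (∀ r ∈ rs, r ∈ IsLocalRing.maximalIdeal R) ∧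
    RingTheory.Sequence.IsWeaklyRegular M rs), (rs.length : ℕ∞)

/-- `grade (M, N) = inf {i | Ext^i_R(M, N) ≠ 0}`, with `inf ∅ = ∞`. -/
noncomputable def extGrade (R : Type u) [CommRing R]
    (M N : Type u) [AddCommGroup M] [Module R M] [AddCommGroup N] [Module R N] : ℕ∞ :=
  ⨅ (i : ℕ) (_ : Nontrivial (Abelian.Ext (ModuleCat.of R M) (ModuleCat.of R N) i)), (i : ℕ∞)

/-- `M` is `N`-perfect: `M` has finite projective dimension, equal to `grade (M, N)`. -/
def IsPerfectRelTo (R : Type u) [CommRing R]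
    (M N : Type u) [AddCommGroup M] [Module R M] [AddCommGroup N] [Module R N] : Prop :=
  projectiveDimension (ModuleCat.of R M) < ⊤ ∧
    projectiveDimension (ModuleCat.of R M) = ((extGrade R M N : ℕ∞) : WithBot ℕ∞)

/-- Serre's condition `(Sₙ)`: `depth M_p ≥ min (n, dim M_p)` for every `p ∈ Supp M`, where depth
and dimension are taken over the local ring `R_p`. -/
def SatisfiesSerre (R : Type u) [CommRing R]
    (M : Type u) [AddCommGroup M] [Module R M] (n : ℕ) : Prop :=
  ∀ p ∈ Module.support R M,
    min ((n : ℕ∞) : WithBot ℕ∞)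
      (Module.supportDim (Localization.AtPrime p.asIdeal)
        (LocalizedModule p.asIdeal.primeCompl M)) ≤
    ((localDepth (Localization.AtPrime p.asIdeal)
        (LocalizedModule p.asIdeal.primeCompl M) : ℕ∞) : WithBot ℕ∞)

/-- `Tor_i^R(M, N)`: the `i`-th left derived functor of `- ⊗ N`, evaluated at `M`. -/
noncomputable def torModule (R : Type u) [CommRing R]
    (M N : Type u) [AddCommGroup M] [Module R M] [AddCommGroup N] [Module R N] (i : ℕ) :
    ModuleCat.{u} R :=
  ((Tor' (ModuleCat.{u} R) i).obj (ModuleCat.of R M)).obj (ModuleCat.of R N)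

/-!
Write `X_p` for the localization of a module `X` at a prime `p` in the support of `M ⊗ N`. The
theorem follows from two inequalities,

* `depth (M ⊗ N)_p ≥ depth N_p - t` (`le_localDepth_localizedModule_tensorProduct`) and
* `dim (M ⊗ N)_p ≤ dim N_p - t` (`supportDim_localizedModule_tensorProduct_add_le`),

since `depth N_p ≥ min (n, dim N_p)`.

The first holds because `M` has a resolution of length `t` by finite projective modules, which by
the vanishing of Tor stays exact after tensoring with `N`. At `p` this resolves `(M ⊗ N)_p` in `t`
steps by modules of depth at least `depth N_p`, and each step costs at most one by the depth lemma
(`le_localDepth_of_exact`), which is read off from the description of depth by `Ext`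
(`le_localDepth_iff_subsingleton_ext`). Only this inequality of the Auslander-Buchsbaum formula is
needed, so `Ext` and Tor themselves are never localized. To pass from `M` to its syzygy, a
projective resolution of the syzygy is extended to one of `M` (`ProjectiveResolution.splice`),
which replaces the long exact sequence of Tor.

The second holds because `grade (M, N) = t`: by Rees' theorem the annihilator of `M` contains an
`N`-regular sequence of length `t` (`exists_isRegular_of_le_extGrade`). It stays regular on `N_p`,
where it cuts the dimension down by exactly `t`, and `(M ⊗ N)_p` is supported on the quotient.
-/

/-! ### Derived functors and splicing of projective resolutions -/

namespace CategoryTheory.ShortComplex.Exact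

variable {C : Type*} [Category* C] [Abelian C]

/-- If `X₁ ⟶ X₂ ⟶ X₃` is exact and factors through a quotient `Z` of `X₂` in which `X₁` dies,
then `Z ⟶ X₃` is a monomorphism. -/
lemma mono_of_epi_of_eq_comp {S : ShortComplex C} (hS : S.Exact) {Z : C} {g : S.X₂ ⟶ Z} (_ : Epi g)
    {h : Z ⟶ S.X₃} (w : S.f ≫ g = 0) (hg : S.g = g ≫ h) : Mono h := by
  rw [Preadditive.mono_iff_cancel_zero]
  intro A a ha
  obtain ⟨A', p, hp, b, hb⟩ := surjective_up_to_refinements_of_epi g a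
  obtain ⟨A'', q, hq, c, hc⟩ := hS.exact_up_to_refinements b (by
    rw [hg, ← Category.assoc, ← hb, Category.assoc, ha, Limits.comp_zero])
  rw [← cancel_epi p, ← cancel_epi q, hb, ← Category.assoc, hc, Category.assoc, w]
  simp

end CategoryTheory.ShortComplex.Exact

namespace CategoryTheory.ProjectiveResolution

variable {C : Type*} [Category* C] [Abelian C] {Z : C} (P : ProjectiveResolution Z)

/-- The augmentation `P₀ ⟶ Z` of a projective resolution `P` of `Z`: the degree zero component of
`P.π`, with target `Z` itself rather than the degree zero term of a single complex. -/
noncomputable def augmentation : P.complex.X 0 ⟶ Z := P.π.f 0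

lemma d_comp_augmentation : P.complex.d 1 0 ≫ P.augmentation = 0 :=
  P.complex_d_comp_π_f_zero

lemma d_comp_augmentation_comp {Y : C} (f : Z ⟶ Y) :
    P.complex.d 1 0 ≫ P.augmentation ≫ f = 0 := by
  rw [← Category.assoc, d_comp_augmentation, Limits.zero_comp]

instance : Epi P.augmentation := inferInstanceAs (Epi (P.π.f 0))

lemma exact_augmentation : (ShortComplex.mk _ _ P.d_comp_augmentation).Exact :=
  ShortComplex.exact_of_g_is_cokernel _ P.isColimitCokernelCofork

/-- The Yoneda splice of a projective resolution `Q` of the kernel with a short exact sequence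
`0 ⟶ K ⟶ F ⟶ X ⟶ 0` whose middle term is projective: the projective resolution
`⋯ ⟶ Q₁ ⟶ Q₀ ⟶ F` of `X`. -/
noncomputable def splice {S : ShortComplex C} (hS : S.ShortExact) [Projective S.X₂]
    (Q : ProjectiveResolution S.X₁) : ProjectiveResolution S.X₃ where
  complex := Q.complex.augment (Q.augmentation ≫ S.f) (Q.d_comp_augmentation_comp S.f)
  projective n := by
    obtain _ | n := n
    · exact ‹Projective S.X₂›
    · exact Q.projective n
  π := (ChainComplex.toSingle₀Equiv _ _).symm ⟨S.g,
    (Category.assoc _ _ _).trans ((congrArg (Q.augmentation ≫ ·) S.zero).trans Limits.comp_zero)⟩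
  quasiIso := ⟨fun n => by
    have := hS.epi_g
    obtain _ | n := n
    · rw [ChainComplex.quasiIsoAt₀_iff, ShortComplex.quasiIso_iff_of_zeros']
      · let T : ShortComplex C := .mk (Q.augmentation ≫ S.f) S.g (by simp)
        have hT : T.Exact := by
          let φ : T ⟶ S := { τ₁ := Q.augmentation, τ₂ := 𝟙 _, τ₃ := 𝟙 _ }
          have : Epi φ.τ₁ := inferInstanceAs (Epi Q.augmentation)
          have : IsIso φ.τ₂ := inferInstanceAs (IsIso (𝟙 S.X₂))
          have : Mono φ.τ₃ := inferInstanceAs (Mono (𝟙 S.X₃))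
          exact (ShortComplex.exact_iff_of_epi_of_isIso_of_mono φ).2 hS.exact
        refine (ShortComplex.exact_and_epi_g_iff_of_iso (S₂ := T) ?_).2
          ⟨hT, inferInstanceAs (Epi S.g)⟩
        refine ShortComplex.isoMk (Iso.refl _) (Iso.refl _) (Iso.refl _) ?_ ?_
        · exact (Category.id_comp _).trans (Category.comp_id _).symm
        · refine (Category.id_comp _).trans (Eq.trans ?_ (Category.comp_id _).symm)
          exact (ChainComplex.toSingle₀Equiv_symm_apply_f_zero
            (C := Q.complex.augment (Q.augmentation ≫ S.f) (Q.d_comp_augmentation_comp S.f))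
            S.g _).symm
      all_goals rfl
    · rw [quasiIsoAt_iff_exactAt']
      · rw [HomologicalComplex.exactAt_iff' _ (n + 1 + 1) (n + 1) n (by simp) (by simp)]
        obtain _ | n := n
        · let φ : ShortComplex.mk _ _ Q.d_comp_augmentation ⟶
              (Q.complex.augment (Q.augmentation ≫ S.f) (Q.d_comp_augmentation_comp S.f)).sc' 2 1 0 :=
            { τ₁ := 𝟙 _, τ₂ := 𝟙 _, τ₃ := S.f
              comm₁₂ := (Category.id_comp _).trans (Category.comp_id _).symm
              comm₂₃ := Category.id_comp _ }
          have : Epi φ.τ₁ := inferInstanceAs (Epi (𝟙 (Q.complex.X 1)))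
          have : IsIso φ.τ₂ := inferInstanceAs (IsIso (𝟙 (Q.complex.X 0)))
          have : Mono φ.τ₃ := hS.mono_f
          exact (ShortComplex.exact_iff_of_epi_of_isIso_of_mono φ).1 Q.exact_augmentation
        · exact Q.exact_succ n
      · apply ChainComplex.exactAt_succ_single_obj⟩

end CategoryTheory.ProjectiveResolution

namespace CategoryTheory.Functor

variable {C D : Type*} [Category* C] [Category* D] [Abelian C] [Abelian D]
  [HasProjectiveResolutions C] (G : C ⥤ D) [G.Additive]

/-- The left derived functor in degree `n + 1` vanishes at `X` if and only if `G` preserves the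
exactness of a given projective resolution of `X` there. -/
lemma isZero_leftDerived_obj_iff_exact {X : C} (P : ProjectiveResolution X) (n : ℕ) :
    Limits.IsZero ((G.leftDerived (n + 1)).obj X) ↔
      ((ShortComplex.mk _ _ (P.complex.d_comp_d (n + 2) (n + 1) n)).map G).Exact := by
  rw [(P.isoLeftDerivedObj G (n + 1)).isZero_iff]
  refine HomologicalComplex.exactAt_iff_isZero_homology _ _ |>.symm.trans ?_
  exact HomologicalComplex.exactAt_iff' _ (n + 2) (n + 1) n (by simp) (by simp)

variable {G} {S : ShortComplex C}

/-- Dimension shifting for left derived functors: the splice with a resolution of `S.X₁` resolves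
`S.X₃`, and in positive degrees it is the resolution of `S.X₁` moved up by one. -/
lemma isZero_leftDerived_obj_X₁ (hS : S.ShortExact) [Projective S.X₂] {n : ℕ}
    (h : Limits.IsZero ((G.leftDerived (n + 2)).obj S.X₃)) :
    Limits.IsZero ((G.leftDerived (n + 1)).obj S.X₁) :=
  (G.isZero_leftDerived_obj_iff_exact (projectiveResolution S.X₁) n).2
    ((G.isZero_leftDerived_obj_iff_exact
      (ProjectiveResolution.splice hS (projectiveResolution S.X₁)) (n + 1)).1 h)

/-- For `G` right exact this is injectivity of `G X₁ ⟶ G X₂` in the long exact sequence of derived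
functors. For a resolution `Q` of `X₁`, vanishing in degree one says that `G` keeps
`Q₁ ⟶ Q₀ ⟶ X₂` exact, so that the kernel of `G Q₀ ⟶ G X₂` dies in `G X₁`. -/
lemma mono_map_f_of_isZero_leftDerived_one (hS : S.ShortExact) [Projective S.X₂]
    [G.PreservesEpimorphisms]
    (h : Limits.IsZero ((G.leftDerived 1).obj S.X₃)) : Mono (G.map S.f) := by
  let Q := projectiveResolution S.X₁
  have hex : ((ShortComplex.mk _ _ (Q.d_comp_augmentation_comp S.f)).map G).Exact :=
    (G.isZero_leftDerived_obj_iff_exact (ProjectiveResolution.splice hS Q) 0).1 h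
  have : Epi (G.map Q.augmentation) := G.map_epi _
  refine hex.mono_of_epi_of_eq_comp this ?_ (G.map_comp _ _)
  exact (G.map_comp _ _).symm.trans ((congrArg G.map Q.d_comp_augmentation).trans (G.map_zero _ _))

end CategoryTheory.Functor

open scoped TensorProduct
open IsLocalRing

/-! ### Depth over a Noetherian local ring -/

section Depth

variable {A : Type u} [CommRing A] [IsLocalRing A]

lemma le_localDepth_of_isWeaklyRegular {L : Type u} [AddCommGroup L] [Module A L] {rs : List A}
    (hmem : ∀ r ∈ rs, r ∈ maximalIdeal A) (hreg : RingTheory.Sequence.IsWeaklyRegular L rs) :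
    (rs.length : ℕ∞) ≤ localDepth A L :=
  le_iSup₂_of_le rs ⟨hmem, hreg⟩ le_rfl

lemma exists_isWeaklyRegular_of_le_localDepth {L : Type u} [AddCommGroup L] [Module A L] {d : ℕ}
    (hd : (d : ℕ∞) ≤ localDepth A L) :
    ∃ rs : List A, d ≤ rs.length ∧ (∀ r ∈ rs, r ∈ maximalIdeal A) ∧
      RingTheory.Sequence.IsWeaklyRegular L rs := by
  obtain _ | d := d
  · exact ⟨[], by simp⟩
  · have hlt : (d : ℕ∞) < localDepth A L :=
      lt_of_lt_of_le (by exact_mod_cast d.lt_succ_self) hd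
    obtain ⟨rs, hrs⟩ := lt_iSup_iff.1 hlt
    obtain ⟨⟨hmem, hreg⟩, hlen⟩ := lt_iSup_iff.1 hrs
    exact ⟨rs, by exact_mod_cast hlen, hmem, hreg⟩

/-- The homological description of depth: a consequence of Rees' theorem. -/
lemma le_localDepth_iff_subsingleton_ext [IsNoetherianRing A] (L : Type u) [AddCommGroup L]
    [Module A L] [Module.Finite A L] (d : ℕ) :
    (d : ℕ∞) ≤ localDepth A L ↔ ∀ i < d,
      Subsingleton (Abelian.Ext (ModuleCat.of A (A ⧸ maximalIdeal A)) (ModuleCat.of A L) i) := by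
  obtain hL | hL := subsingleton_or_nontrivial L
  -- Both sides hold for the zero module, on which `0, …, 0` is weakly regular.
  · refine iff_of_true ?_ fun i _ ↦ ?_
    · have hreg : RingTheory.Sequence.IsWeaklyRegular L (List.replicate d (0 : A)) :=
        ⟨fun i hi a b _ ↦ Subsingleton.elim a b⟩
      simpa using le_localDepth_of_isWeaklyRegular
        (fun r hr ↦ by simp [List.eq_of_mem_replicate hr]) hreg
    · have h0 : Limits.IsZero (ModuleCat.of A L) := ModuleCat.isZero_of_subsingleton _
      refine ⟨fun a b ↦ ?_⟩
      rw [← a.comp_mk₀_id, ← b.comp_mk₀_id, h0.eq_of_src (𝟙 _) 0]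
      simp
  · have hlt : maximalIdeal A • (⊤ : Submodule A L) < ⊤ := lt_top_iff_ne_top.2
      (Submodule.top_ne_ideal_smul_of_le_jacobson_annihilator (maximalIdeal_le_jacobson _)).symm
    have hsupp : Module.support A (A ⧸ maximalIdeal A) =
        PrimeSpectrum.zeroLocus (maximalIdeal A : Set A) := by
      rw [Module.support_eq_zeroLocus, Ideal.annihilator_quotient]
    constructor
    · intro hd i hi
      obtain ⟨rs, hlen, hmem, hreg⟩ := exists_isWeaklyRegular_of_le_localDepth hd
      exact ModuleCat.subsingleton_ext_of_exists_isRegular (maximalIdeal A)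
        (ModuleCat.of A (A ⧸ maximalIdeal A)) hsupp.le (ModuleCat.of A L) hlt rs hmem
        (.of_isWeaklyRegular_of_mem_maximalIdeal _ hmem hreg) i (hi.trans_le hlen)
    · intro h
      obtain ⟨rs, rfl, hmem, hreg⟩ := ModuleCat.exists_isRegular_of_exists_subsingleton_ext
        (maximalIdeal A) d (ModuleCat.of A L) hlt (ModuleCat.of A (A ⧸ maximalIdeal A)) hsupp h
      exact le_localDepth_of_isWeaklyRegular hmem hreg.toIsWeaklyRegular

/-- The depth lemma, bounding the depth of the cokernel: by the long exact sequence,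
`Extⁱ(k, L₃)` sits between `Extⁱ(k, L₂)` and `Extⁱ⁺¹(k, L₁)`. -/
lemma le_localDepth_of_exact [IsNoetherianRing A] {L₁ L₂ L₃ : Type u}
    [AddCommGroup L₁] [Module A L₁] [Module.Finite A L₁] [AddCommGroup L₂] [Module A L₂]
    [Module.Finite A L₂] [AddCommGroup L₃] [Module A L₃] [Module.Finite A L₃]
    {f : L₁ →ₗ[A] L₂} {g : L₂ →ₗ[A] L₃} (hf : Function.Injective f) (hfg : Function.Exact f g)
    (hg : Function.Surjective g) {d : ℕ} (h₁ : ((d + 1 : ℕ) : ℕ∞) ≤ localDepth A L₁)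
    (h₂ : (d : ℕ∞) ≤ localDepth A L₂) : (d : ℕ∞) ≤ localDepth A L₃ := by
  rw [le_localDepth_iff_subsingleton_ext] at h₁ h₂ ⊢
  intro i hi
  let S : ShortComplex (ModuleCat.{u} A) :=
    ModuleCat.shortComplexOfCompEqZero f g hfg.linearMap_comp_eq_zero
  have hS : S.ShortExact := ModuleCat.shortComplex_shortExact S hfg hf hg
  have z₁ := AddCommGrpCat.isZero_of_iff_subsingleton.mpr (h₁ (i + 1) (by lia))
  have z₂ := AddCommGrpCat.isZero_of_iff_subsingleton.mpr (h₂ i hi)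
  exact AddCommGrpCat.subsingleton_of_isZero <| ShortComplex.Exact.isZero_of_both_zeros
    (Abelian.Ext.covariant_sequence_exact₃' _ hS i (i + 1) rfl)
    (z₂.eq_zero_of_src _) (z₁.eq_zero_of_tgt _)

lemma localDepth_le_of_linearEquiv {L L' : Type u} [AddCommGroup L] [Module A L]
    [AddCommGroup L'] [Module A L'] (e : L ≃ₗ[A] L') : localDepth A L ≤ localDepth A L' :=
  iSup₂_le fun _ h ↦ le_localDepth_of_isWeaklyRegular h.1 ((e.isWeaklyRegular_congr _).1 h.2)

lemma localDepth_le_localDepth_tensorProduct (P L : Type u) [AddCommGroup P] [Module A P]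
    [Module.Flat A P] [AddCommGroup L] [Module A L] :
    localDepth A L ≤ localDepth A (P ⊗[A] L) :=
  iSup₂_le fun _ h ↦ le_localDepth_of_isWeaklyRegular h.1 h.2.isWeaklyRegular_lTensor

end Depth

/-! ### Tor and syzygies -/

section Tor

variable {R : Type u} [CommRing R]

open MonoidalCategory

instance (N : ModuleCat.{u} R) :
    ((tensoringRight (ModuleCat.{u} R)).obj N).PreservesEpimorphisms where
  preserves f hf := by
    rw [ModuleCat.epi_iff_surjective] at hf ⊢
    exact LinearMap.rTensor_surjective N hf

variable {K F M : Type u} [AddCommGroup K] [Module R K] [AddCommGroup F] [Module R F]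
  [AddCommGroup M] [Module R M] (N : Type u) [AddCommGroup N] [Module R N]

lemma rTensor_injective_of_subsingleton_torModule [Module.Projective R F] {f : F →ₗ[R] M}
    (hf : Function.Surjective f) (h : Subsingleton (torModule R M N 1)) :
    Function.Injective ((LinearMap.ker f).subtype.rTensor N) := by
  have hS := LinearMap.shortExact_shortComplexKer hf
  have : Projective f.shortComplexKer.X₂ := inferInstanceAs (Projective (ModuleCat.of R F))
  have := Functor.mono_map_f_of_isZero_leftDerived_one
    (G := (tensoringRight (ModuleCat.{u} R)).obj (ModuleCat.of R N)) hS
    (ModuleCat.isZero_of_iff_subsingleton.2 h)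
  exact (ModuleCat.mono_iff_injective _).1 this

lemma subsingleton_torModule_ker [Module.Projective R F] {f : F →ₗ[R] M}
    (hf : Function.Surjective f) {n : ℕ} (h : Subsingleton (torModule R M N (n + 2))) :
    Subsingleton (torModule R (LinearMap.ker f) N (n + 1)) := by
  have hS := LinearMap.shortExact_shortComplexKer hf
  have : Projective f.shortComplexKer.X₂ := inferInstanceAs (Projective (ModuleCat.of R F))
  have h0 : Limits.IsZero (torModule R (LinearMap.ker f) N (n + 1)) :=
    Functor.isZero_leftDerived_obj_X₁
      (G := (tensoringRight (ModuleCat.{u} R)).obj (ModuleCat.of R N)) hS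
      (ModuleCat.isZero_of_iff_subsingleton.2 h)
  exact ModuleCat.subsingleton_of_isZero h0

end Tor

/-! ### Depth of tensor products at a prime -/

section Localization

variable {R : Type u} [CommRing R] (p : Ideal R) [p.IsPrime]

/-- Localization at a prime commutes with tensor products. -/
noncomputable def LocalizedModule.tensorEquivAtPrime (M N : Type u) [AddCommGroup M] [Module R M]
    [AddCommGroup N] [Module R N] :
    LocalizedModule p.primeCompl M ⊗[Localization.AtPrime p] LocalizedModule p.primeCompl N
      ≃ₗ[Localization.AtPrime p] LocalizedModule p.primeCompl (M ⊗[R] N) :=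
  (IsLocalization.moduleTensorEquiv p.primeCompl (Localization.AtPrime p) _ _).trans
    ((IsLocalizedModule.iso p.primeCompl
      (TensorProduct.map (LocalizedModule.mkLinearMap p.primeCompl M)
        (LocalizedModule.mkLinearMap p.primeCompl N))).symm.extendScalarsOfIsLocalization
          p.primeCompl _)

/-- If `M` has projective dimension at most `t` and `Tor_i(M, N) = 0` for `i > 0`, then tensoring
with `M` lowers the local depths of `N` by at most `t`. The proof is by induction on `t`: for a
presentation `0 → K → F → M → 0` with `F` finite free, `K` inherits the Tor vanishing, and
`0 → K ⊗ N → F ⊗ N → M ⊗ N → 0` is exact because `Tor₁(M, N) = 0`. -/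
lemma le_localDepth_localizedModule_tensorProduct [IsNoetherianRing R]
    (N : Type u) [AddCommGroup N] [Module R N] [Module.Finite R N]
    {M : Type u} [AddCommGroup M] [Module R M] [Module.Finite R M] {t : ℕ}
    (hM : HasProjectiveDimensionLE (ModuleCat.of R M) t)
    (hTor : ∀ i : ℕ, 0 < i → Subsingleton (torModule R M N i)) {d : ℕ}
    (hd : ((d + t : ℕ) : ℕ∞) ≤
      localDepth (Localization.AtPrime p) (LocalizedModule p.primeCompl N)) :
    (d : ℕ∞) ≤
      localDepth (Localization.AtPrime p) (LocalizedModule p.primeCompl (M ⊗[R] N)) := by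
  have key (P : Type u) [AddCommGroup P] [Module R P] [Module.Projective R P] :
      localDepth (Localization.AtPrime p) (LocalizedModule p.primeCompl N) ≤
      localDepth (Localization.AtPrime p) (LocalizedModule p.primeCompl (P ⊗[R] N)) :=
    (localDepth_le_localDepth_tensorProduct _ _).trans
      (localDepth_le_of_linearEquiv (LocalizedModule.tensorEquivAtPrime p P N))
  induction t generalizing M d with
  | zero =>
    have : Projective (ModuleCat.of R M) := (projective_iff_hasProjectiveDimensionLE_zero _).2 hM
    have : Module.Projective R M := (IsProjective.iff_projective M).2 this
    exact hd.trans (key M)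
  | succ t ih =>
    obtain ⟨F, _, _, _, _, f, hf⟩ := Module.exists_finite_presentation R M
    have hS := LinearMap.shortExact_shortComplexKer hf
    have hK : HasProjectiveDimensionLE (ModuleCat.of R (LinearMap.ker f)) t :=
      (hS.hasProjectiveDimensionLT_X₃_iff t (inferInstanceAs (Projective (ModuleCat.of R F)))).1 hM
    have hKN := ih (M := LinearMap.ker f) (d := d + 1) hK
      (fun i hi ↦ by
        obtain ⟨i, rfl⟩ := Nat.exists_eq_succ_of_ne_zero hi.ne'
        exact subsingleton_torModule_ker N hf (hTor (i + 2) (by lia)))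
      (le_trans (by norm_cast; lia) hd)
    have hinj := rTensor_injective_of_subsingleton_torModule N hf (hTor 1 one_pos)
    have hex : Function.Exact ((LinearMap.ker f).subtype.rTensor N) (f.rTensor N) :=
      rTensor_exact N (LinearMap.exact_subtype_ker_map f) hf
    refine le_localDepth_of_exact
      (f := LocalizedModule.map p.primeCompl ((LinearMap.ker f).subtype.rTensor N))
      (g := LocalizedModule.map p.primeCompl (f.rTensor N))
      (LocalizedModule.map_injective _ _ hinj) (LocalizedModule.map_exact _ _ _ hex)
      (LocalizedModule.map_surjective _ _ (LinearMap.rTensor_surjective N hf)) hKN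
      (le_trans (le_trans (by norm_cast; lia) hd) (key F))

end Localization

/-! ### Grade and the dimension of tensor products -/

section Dimension

lemma annihilator_le_annihilator_tensorProduct_left {A : Type*} [CommRing A] (M N : Type*)
    [AddCommGroup M] [Module A M] [AddCommGroup N] [Module A N] :
    Module.annihilator A M ≤ Module.annihilator A (M ⊗[A] N) := by
  intro a ha
  rw [Module.mem_annihilator] at ha ⊢
  intro z
  induction z with
  | zero => simp
  | tmul x y => rw [TensorProduct.smul_tmul', ha, TensorProduct.zero_tmul]
  | add x y hx hy => rw [smul_add, hx, hy, add_zero]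

lemma annihilator_le_annihilator_tensorProduct_right {A : Type*} [CommRing A] (M N : Type*)
    [AddCommGroup M] [Module A M] [AddCommGroup N] [Module A N] :
    Module.annihilator A N ≤ Module.annihilator A (M ⊗[A] N) :=
  (annihilator_le_annihilator_tensorProduct_left N M).trans
    (TensorProduct.comm A N M).annihilator_eq.le

lemma support_tensorProduct_subset_right {A : Type*} [CommRing A] (M N : Type*)
    [AddCommGroup M] [Module A M] [Module.Finite A M] [AddCommGroup N] [Module A N]
    [Module.Finite A N] : Module.support A (M ⊗[A] N) ⊆ Module.support A N := by
  rw [Module.support_eq_zeroLocus, Module.support_eq_zeroLocus]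
  exact PrimeSpectrum.zeroLocus_anti_mono (annihilator_le_annihilator_tensorProduct_right M N)

/-- An `N`-regular sequence annihilating `M` cuts the dimension of `M ⊗ N` down from that of `N`
by at least its length. -/
lemma supportDim_tensorProduct_add_length_le {A : Type*} [CommRing A] [IsLocalRing A]
    [IsNoetherianRing A] (M N : Type*) [AddCommGroup M] [Module A M] [Module.Finite A M]
    [AddCommGroup N] [Module A N] [Module.Finite A N] {rs : List A}
    (hmem : ∀ r ∈ rs, r ∈ Module.annihilator A M) (hreg : RingTheory.Sequence.IsRegular N rs) :
    Module.supportDim A (M ⊗[A] N) + rs.length ≤ Module.supportDim A N := by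
  rw [← Module.supportDim_add_length_eq_supportDim_of_isRegular rs hreg]
  gcongr
  refine Order.krullDim_le_of_strictMono (Set.inclusion ?_) fun _ _ h ↦ h
  rw [Module.support_quotient]
  refine Set.subset_inter (support_tensorProduct_subset_right M N) ?_
  rw [Module.support_eq_zeroLocus]
  refine PrimeSpectrum.zeroLocus_anti_mono ?_
  exact (Ideal.span_le.2 hmem).trans (annihilator_le_annihilator_tensorProduct_left M N)

/-- Rees' theorem for the grade: if `grade (M, N) ≥ t`, the annihilator of `M` contains an
`N`-regular sequence of length `t`. -/
lemma exists_isRegular_of_le_extGrade {R : Type u} [CommRing R] [IsNoetherianRing R] [IsLocalRing R]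
    {M N : Type u} [AddCommGroup M] [Module R M] [Module.Finite R M] [Nontrivial M]
    [AddCommGroup N] [Module R N] [Module.Finite R N] [Nontrivial N] {t : ℕ}
    (h : (t : ℕ∞) ≤ extGrade R M N) :
    ∃ rs : List R, rs.length = t ∧ (∀ r ∈ rs, r ∈ Module.annihilator R M) ∧
      RingTheory.Sequence.IsRegular N rs := by
  refine ModuleCat.exists_isRegular_of_exists_subsingleton_ext (Module.annihilator R M) t
    (ModuleCat.of R N) (lt_top_iff_ne_top.2 (Ne.symm ?_)) (ModuleCat.of R M)
    Module.support_eq_zeroLocus fun i hi ↦ ?_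
  · exact Submodule.top_ne_ideal_smul_of_le_jacobson_annihilator
      ((le_maximalIdeal fun h ↦ not_subsingleton M
        (Module.annihilator_eq_top_iff.1 h)).trans (maximalIdeal_le_jacobson _))
  · by_contra hne
    rw [not_subsingleton_iff_nontrivial] at hne
    have : extGrade R M N ≤ i := iInf₂_le i hne
    exact absurd (h.trans this) (by exact_mod_cast hi.not_ge)

/-- If `grade (M, N) ≥ t`, then at each prime of its support `M ⊗ N` has dimension at most that of
`N`, minus `t`. -/
lemma supportDim_localizedModule_tensorProduct_add_le {R : Type u} [CommRing R]
    [IsNoetherianRing R] [IsLocalRing R] {M N : Type u} [AddCommGroup M] [Module R M]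
    [Module.Finite R M] [Nontrivial M] [AddCommGroup N] [Module R N] [Module.Finite R N]
    [Nontrivial N] {t : ℕ} (h : (t : ℕ∞) ≤ extGrade R M N) {p : PrimeSpectrum R}
    (hp : p ∈ Module.support R (M ⊗[R] N)) :
    Module.supportDim (Localization.AtPrime p.asIdeal)
        (LocalizedModule p.asIdeal.primeCompl (M ⊗[R] N)) + t ≤
      Module.supportDim (Localization.AtPrime p.asIdeal)
        (LocalizedModule p.asIdeal.primeCompl N) := by
  obtain ⟨rs, rfl, hmem, hreg⟩ := exists_isRegular_of_le_extGrade h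
  have hpM : Module.annihilator R M ≤ p.asIdeal :=
    (annihilator_le_annihilator_tensorProduct_left M N).trans
      (Module.annihilator_le_of_mem_support hp)
  have hpN : p ∈ Module.support R N := support_tensorProduct_subset_right M N hp
  have : Nontrivial (LocalizedModule p.asIdeal.primeCompl N) := hpN
  have hreg' : RingTheory.Sequence.IsRegular (LocalizedModule p.asIdeal.primeCompl N)
      (rs.map (algebraMap R (Localization.AtPrime p.asIdeal))) :=
    hreg.toIsWeaklyRegular.isRegular_of_isLocalizedModule_of_mem _ p.asIdeal
      (LocalizedModule.mkLinearMap p.asIdeal.primeCompl N) fun r hr ↦ hpM (hmem r hr)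
  rw [← Module.supportDim_eq_of_equiv (LocalizedModule.tensorEquivAtPrime p.asIdeal M N)]
  refine le_trans (le_of_eq (by rw [List.length_map])) (supportDim_tensorProduct_add_length_le
    (LocalizedModule p.asIdeal.primeCompl M) _ ?_ hreg')
  rintro _ hr
  obtain ⟨r, hr', rfl⟩ := List.mem_map.1 hr
  rw [Module.mem_annihilator]
  intro m
  induction m with | _ m s
  rw [algebraMap_smul, LocalizedModule.smul'_mk, Module.mem_annihilator.1 (hmem r hr'),
    LocalizedModule.zero_mk]

end Dimension

theorem theorem2p1 (R : Type u) [CommRing R] [IsLocalRing R] [IsNoetherianRing R]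
    (M N : Type u) [AddCommGroup M] [Module R M] [Module.Finite R M] [Nontrivial M]
    [AddCommGroup N] [Module R N] [Module.Finite R N] [Nontrivial N]
    (n t : ℕ) (hN : SatisfiesSerre R N n)
    (hM : IsPerfectRelTo R M N)
    (ht : projectiveDimension (ModuleCat.of R M) = ((t : ℕ∞) : WithBot ℕ∞)) (htn : t ≤ n)
    (hTor : ∀ i : ℕ, 0 < i → Subsingleton (torModule R M N i)) :
    SatisfiesSerre R (TensorProduct R M N) (n - t) := by
  intro p hp
  have hgrade : (t : ℕ∞) ≤ extGrade R M N := WithBot.coe_le_coe.1 (ht.symm.trans hM.2).le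
  have hpd : HasProjectiveDimensionLE (ModuleCat.of R M) t :=
    (projectiveDimension_le_iff _ t).1 ht.le
  have hdim := supportDim_localizedModule_tensorProduct_add_le hgrade hp
  have hdepth := hN p (support_tensorProduct_subset_right M N hp)
  have : Nontrivial (LocalizedModule p.asIdeal.primeCompl (M ⊗[R] N)) := hp
  obtain ⟨D, hD⟩ := WithBot.ne_bot_iff_exists.1 (Module.supportDim_ne_bot_of_nontrivial
    (Localization.AtPrime p.asIdeal) (LocalizedModule p.asIdeal.primeCompl (M ⊗[R] N)))
  rw [← hD] at hdim ⊢
  -- the left-hand side is a natural number `d`, as it is at most `n - t`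
  obtain ⟨d, hd⟩ := ENat.ne_top_iff_exists.1
    (ne_top_of_le_ne_top (ENat.natCast_ne_top (n - t)) (min_le_left ((n - t : ℕ) : ℕ∞) D))
  have hdn : d ≤ n - t := by exact_mod_cast hd.trans_le (min_le_left _ _)
  have hdD : (d : ℕ∞) ≤ D := hd.trans_le (min_le_right _ _)
  rw [← WithBot.coe_min, ← hd, WithBot.coe_le_coe]
  refine le_localDepth_localizedModule_tensorProduct p.asIdeal N hpd hTor ?_
  rw [← WithBot.coe_le_coe]
  refine le_trans (le_min ?_ (le_trans ?_ hdim)) hdepth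
  · exact WithBot.coe_le_coe.2 (by exact_mod_cast Nat.add_le_of_le_sub htn hdn)
  · have : ((d + t : ℕ) : ℕ∞) ≤ D + t := by push_cast; gcongr
    exact WithBot.coe_le_coe.2 this
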